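/- Call a polytope a bounded set of solutions of finitely many linear inequalities. A formulation of a polytope $P\subseteq\mathbb{R}^d$ of size $N$ with $m$ additional variables is a system of $N$ linear inequalities $Ax+By\le b$ in the variables $(x,y)\in\mathbb{R}^d\times\mathbb{R}^m$ whose solution set $Q\subseteq\mathbb{R}^{d+m}$ is a polytope with $P=\{x\in\mathbb{R}^d:\exists\,y\in\mathbb{R}^m,\ (x,y)\in Q\}$. **Theorem.** Let $\sigma$ be a real univariate polynomial. There are a constant $c>0$ and a number $d_0\in\mathbb{N}$, both depending only on $\sigma$, such that for every odd $d\in\mathbb{N}$ there exist nonempty polytopes $P_1,P_2\subseteq\mathbb{R}^d$, described by $f_1$ and $f_2$ linear inequalities in $\mathbb{R}^d$ respectively (that is, by formulations of sizes $f_1$ and $f_2$ without additional variables), with the following property: if $d\ge d_0$, then every formulation of $\operatorname{conv}(P_1\cup P_2)$ of size at most $\sigma(f_1+f_2)$ has at least $c\,d$ additional variables. -/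

import Mathlib

open scoped Matrix

/-- The set `Q = {(x, y) ∈ ℝ^d × ℝ^m : A x + B y ≤ b}` of solutions of a system of `N` linear
inequalities in the `d` original variables `x` and the `m` additional variables `y`. -/
def solutionSet {d m N : ℕ} (A : Matrix (Fin N) (Fin d) ℝ) (B : Matrix (Fin N) (Fin m) ℝ)
    (b : Fin N → ℝ) : Set ((Fin d → ℝ) × (Fin m → ℝ)) :=
  {z | A *ᵥ z.1 + B *ᵥ z.2 ≤ b}

/-- The system `A x + B y ≤ b` is a formulation of `P ⊆ ℝ^d`: its solution set `Q ⊆ ℝ^{d+m}` is a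
polytope (a bounded polyhedron) and is a linear extension of `P`, that is,
`P = proj_x(Q) = {x : ∃ y, (x, y) ∈ Q}`. -/
def IsFormulation {d m N : ℕ} (A : Matrix (Fin N) (Fin d) ℝ) (B : Matrix (Fin N) (Fin m) ℝ)
    (b : Fin N → ℝ) (P : Set (Fin d → ℝ)) : Prop :=
  Bornology.IsBounded (solutionSet A B b) ∧ P = {x | ∃ y, (x, y) ∈ solutionSet A B b}

/-- `P ⊆ ℝ^d` has a formulation with `m` additional variables and of size `N`
(that is, with `N` inequalities). For `m = 0` this says that `P` is a polytope described by `N`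
linear inequalities in `ℝ^d` itself. -/
def HasFormulation {d : ℕ} (P : Set (Fin d → ℝ)) (m N : ℕ) : Prop :=
  ∃ (A : Matrix (Fin N) (Fin d) ℝ) (B : Matrix (Fin N) (Fin m) ℝ) (b : Fin N → ℝ),
    IsFormulation A B b P

/-! The hull has too many facets. Over a facet with normal `u`, the tight rows of a formulation span
a space `W` that contains `u`. Any member of `W` free of additional variables is constant on the
facet, hence a multiple of `u`. So `dim W ≤ m + 1`, and some `m + 1` rows determine `u` up to
scaling: there are at most `N ^ (m + 1)` facets (`card_le_of_isFacetNormal`).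

With `d = 2k + 1`, take a product of `k` polygons at height 0 and a simplex at height 1. Every
choice of one edge per polygon joins the same simplex facet in a facet of the hull
(`isFacetNormal_edgeNormal`). With `d` edges per polygon this gives `d ^ k` facets from `O(d²)`
inequalities, so a size polynomial in `d` forces `m` to be linear in `d`. -/

/-- `u` is the normal vector of a facet of `P` (or of all of `P`), witnessed by a finite nonempty
family of maximisers of `u` over `P` that determines `u` up to a scalar. -/
def IsFacetNormal {d : ℕ} (P : Set (Fin d → ℝ)) (u : Fin d → ℝ) : Prop :=
  ∃ T : Finset (Fin d → ℝ), T.Nonempty ∧ (∀ p ∈ T, p ∈ P) ∧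
    (∀ p ∈ T, ∀ x ∈ P, u ⬝ᵥ x ≤ u ⬝ᵥ p) ∧
    ∀ w : Fin d → ℝ, (∀ p ∈ T, ∀ q ∈ T, w ⬝ᵥ p = w ⬝ᵥ q) → ∃ c : ℝ, w = c • u

/-! ### Counting facets through tight rows -/

/-- The linear functional given by the left hand side of the `i`-th inequality. -/
noncomputable def rowFunctional {d m N : ℕ} (A : Matrix (Fin N) (Fin d) ℝ)
    (B : Matrix (Fin N) (Fin m) ℝ) (i : Fin N) :
    ((Fin d → ℝ) × (Fin m → ℝ)) →ₗ[ℝ] ℝ :=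
  LinearMap.proj i ∘ₗ (A.mulVecLin.coprod B.mulVecLin)

lemma rowFunctional_apply {d m N : ℕ} (A : Matrix (Fin N) (Fin d) ℝ)
    (B : Matrix (Fin N) (Fin m) ℝ) (i : Fin N) (z : (Fin d → ℝ) × (Fin m → ℝ)) :
    rowFunctional A B i z = (A *ᵥ z.1 + B *ᵥ z.2) i := by
  simp [rowFunctional]

lemma mem_solutionSet_iff {d m N : ℕ} {A : Matrix (Fin N) (Fin d) ℝ}
    {B : Matrix (Fin N) (Fin m) ℝ} {b : Fin N → ℝ} {z : (Fin d → ℝ) × (Fin m → ℝ)} :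
    z ∈ solutionSet A B b ↔ ∀ i, rowFunctional A B i z ≤ b i := by
  simp only [rowFunctional_apply]; rfl

/-- The functional `(x, y) ↦ u ⬝ x`. -/
noncomputable def liftFunctional {d : ℕ} (m : ℕ) (u : Fin d → ℝ) :
    ((Fin d → ℝ) × (Fin m → ℝ)) →ₗ[ℝ] ℝ :=
  (dotProductBilin ℝ ℝ u) ∘ₗ LinearMap.fst ℝ _ _

lemma liftFunctional_apply {d m : ℕ} (u : Fin d → ℝ) (z : (Fin d → ℝ) × (Fin m → ℝ)) :
    liftFunctional m u z = u ⬝ᵥ z.1 := rfl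

/-- A functional which is maximised over `Q` at `q` is a combination of the rows tight at `q`. -/
lemma liftFunctional_mem_span_tight {d m N : ℕ} (A : Matrix (Fin N) (Fin d) ℝ)
    (B : Matrix (Fin N) (Fin m) ℝ) (b : Fin N → ℝ) (u : Fin d → ℝ)
    (q : (Fin d → ℝ) × (Fin m → ℝ)) (hq : q ∈ solutionSet A B b)
    (hmax : ∀ z ∈ solutionSet A B b, liftFunctional m u z ≤ liftFunctional m u q) :
    liftFunctional m u ∈ Submodule.span ℝ
      (rowFunctional A B '' {i | rowFunctional A B i q = b i}) := by
  rw [Set.image_eq_range]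
  apply mem_span_of_iInf_ker_le_ker
  intro z hz
  simp only [Submodule.mem_iInf, LinearMap.mem_ker, Subtype.forall, Set.mem_ofPred_eq] at hz
  -- A direction killed by all tight rows can be followed both ways from `q` inside `Q`, since the
  -- slack rows stay slack nearby; maximality then forces `u` to vanish on it.
  have hev : ∀ᶠ ε : ℝ in nhds 0, ∀ i, rowFunctional A B i (q + ε • z) ≤ b i := by
    rw [Filter.eventually_all]
    intro i
    rcases (mem_solutionSet_iff.1 hq i).eq_or_lt with h | h
    · exact .of_forall fun ε => by simp [hz i h, h]
    · have hc : ContinuousAt (fun ε : ℝ => rowFunctional A B i (q + ε • z)) 0 := by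
        simp only [map_add, map_smul, smul_eq_mul]
        fun_prop
      filter_upwards [hc.eventually_lt_const (by simpa using h)] with ε hε using hε.le
  obtain ⟨δ, hδ, hball⟩ := Metric.eventually_nhds_iff.1 hev
  have key : ∀ ε : ℝ, |ε| < δ → ε * liftFunctional m u z ≤ 0 := by
    intro ε hε
    have := hmax _ (mem_solutionSet_iff.2 (hball (by simpa using hε)))
    rw [map_add, map_smul, smul_eq_mul] at this
    linarith
  have h1 := key (δ / 2) (by rw [abs_of_pos] <;> linarith)
  have h2 := key (-(δ / 2)) (by rw [abs_neg, abs_of_pos] <;> linarith)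
  rw [LinearMap.mem_ker]
  nlinarith

/-- A functional that does not depend on the additional variables comes from a vector. -/
lemma exists_eq_liftFunctional {d m : ℕ} (φ : ((Fin d → ℝ) × (Fin m → ℝ)) →ₗ[ℝ] ℝ)
    (h : φ ∘ₗ LinearMap.inr ℝ _ _ = 0) : ∃ w, φ = liftFunctional m w := by
  refine ⟨fun j => φ (fun k => if j = k then 1 else 0, 0), LinearMap.prod_ext ?_ ?_⟩
  · ext1 j
    ext
    simp [liftFunctional_apply, dotProduct, Pi.single_apply]
    congr 2
    ext k
    simp [Pi.single_apply, eq_comm]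
  · rw [h]
    ext
    simp [liftFunctional_apply]

/-- The rows tight along the lift of a facet span a space of dimension at most `m + 1` which
meets the functionals not involving the additional variables exactly in the facet normal. -/
lemma exists_rows_of_isFacetNormal {d m N : ℕ} {A : Matrix (Fin N) (Fin d) ℝ}
    {B : Matrix (Fin N) (Fin m) ℝ} {b : Fin N → ℝ} {P : Set (Fin d → ℝ)}
    (hP : IsFormulation A B b P) {u : Fin d → ℝ} (hu0 : u ≠ 0) (hu : IsFacetNormal P u) :
    ∃ g : Fin (m + 1) → Fin N,
      liftFunctional m u ∈ Submodule.span ℝ (Set.range (rowFunctional A B ∘ g)) ∧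
      ∀ w, liftFunctional m w ∈ Submodule.span ℝ (Set.range (rowFunctional A B ∘ g)) →
        ∃ c : ℝ, w = c • u := by
  obtain ⟨T, hTne, hTP, hTmax, hTu⟩ := hu
  have hPmem : ∀ x, x ∈ P ↔ ∃ y, (x, y) ∈ solutionSet A B b := fun x => by rw [hP.2]; rfl
  choose! Y hY using fun p (hp : p ∈ T) => (hPmem p).1 (hTP p hp)
  have hcard : (0 : ℝ) < T.card := by exact_mod_cast hTne.card_pos
  -- At the barycentre of the lifted points, a row is tight only if it is tight at every one of
  -- them.
  set q : (Fin d → ℝ) × (Fin m → ℝ) := (T.card : ℝ)⁻¹ • ∑ p ∈ T, (p, Y p) with hqdef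
  have hφq : ∀ φ : ((Fin d → ℝ) × (Fin m → ℝ)) →ₗ[ℝ] ℝ,
      φ q = (T.card : ℝ)⁻¹ * ∑ p ∈ T, φ (p, Y p) := fun φ => by
    rw [hqdef, map_smul, map_sum, smul_eq_mul]
  have hrow : ∀ i, ∀ p ∈ T, rowFunctional A B i (p, Y p) ≤ b i := fun i p hp =>
    mem_solutionSet_iff.1 (hY p hp) i
  have hq : q ∈ solutionSet A B b := by
    rw [mem_solutionSet_iff]
    intro i
    rw [hφq, inv_mul_le_iff₀ hcard]
    simpa using Finset.sum_le_sum (hrow i)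
  have hqmax : ∀ z ∈ solutionSet A B b, liftFunctional m u z ≤ liftFunctional m u q := by
    intro z hz
    rw [hφq, le_inv_mul_iff₀ hcard]
    have hz' : z.1 ∈ P := (hPmem _).2 ⟨z.2, hz⟩
    simpa [liftFunctional_apply] using Finset.sum_le_sum (fun p hp => hTmax p hp z.1 hz')
  set S := {i | rowFunctional A B i q = b i} with hS
  have hmem := liftFunctional_mem_span_tight A B b u q hq hqmax
  set W := Submodule.span ℝ (rowFunctional A B '' S) with hW
  have htight : ∀ i ∈ S, ∀ p ∈ T, rowFunctional A B i (p, Y p) = b i := by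
    intro i hi
    have h1 : rowFunctional A B i q = b i := hi
    rw [hφq, inv_mul_eq_iff_eq_mul₀ hcard.ne'] at h1
    exact (Finset.sum_eq_sum_iff_of_le (hrow i)).1 (by simpa using h1)
  have hconst : ∀ φ ∈ W, ∀ p ∈ T, ∀ p' ∈ T, φ (p, Y p) = φ (p', Y p') := by
    intro φ hφ p hp p' hp'
    induction hφ using Submodule.span_induction with
    | mem φ h =>
      obtain ⟨i, hi, rfl⟩ := h
      rw [htight i hi p hp, htight i hi p' hp']
    | zero => rfl
    | add φ ψ _ _ h1 h2 => simp [h1, h2]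
    | smul c φ _ h => simp [h]
  have hline : ∀ w, liftFunctional m w ∈ W → ∃ c : ℝ, w = c • u := fun w hw =>
    hTu w fun p hp p' hp' => hconst _ hw p hp p' hp'
  have hrank : Module.finrank ℝ W ≤ m + 1 := by
    -- Restriction to the additional variables: the range has dimension at most `m`, and the kernel
    -- is the line through `u`.
    let ρ : W →ₗ[ℝ] ((Fin m → ℝ) →ₗ[ℝ] ℝ) :=
      (LinearMap.lcomp ℝ ℝ (LinearMap.inr ℝ (Fin d → ℝ) (Fin m → ℝ))) ∘ₗ W.subtype
    have h1 : Module.finrank ℝ (LinearMap.range ρ) ≤ m := by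
      refine (Submodule.finrank_le _).trans ?_
      simp
    have h2 : Module.finrank ℝ (LinearMap.ker ρ) ≤ 1 := by
      refine finrank_le_one ⟨⟨liftFunctional m u, hmem⟩, ?_⟩ ?_
      · ext
        simp [ρ, liftFunctional_apply]
      · rintro ⟨⟨φ, hφW⟩, hφ⟩
        obtain ⟨w, rfl⟩ := exists_eq_liftFunctional φ hφ
        obtain ⟨c, rfl⟩ := hline w hφW
        refine ⟨c, ?_⟩
        ext
        all_goals simp [liftFunctional_apply]
    have := LinearMap.finrank_range_add_finrank_ker (K := ℝ) (V := W) ρ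
    omega
  have hpos : 0 < Module.finrank ℝ W := by
    have : Nontrivial W := by
      refine ⟨⟨⟨_, hmem⟩, 0, fun h => hu0 ?_⟩⟩
      have h' : liftFunctional m u = 0 := congrArg Subtype.val h
      have := LinearMap.congr_fun h' (u, 0)
      exact dotProduct_self_eq_zero.1 this
    exact Module.finrank_pos (R := ℝ) (M := W)
  obtain ⟨k, hk0, hkm, f, hf, hfspan⟩ : ∃ k, 0 < k ∧ k ≤ m + 1 ∧
      ∃ f : Fin k → (((Fin d → ℝ) × (Fin m → ℝ)) →ₗ[ℝ] ℝ),
        (∀ i, f i ∈ rowFunctional A B '' S) ∧ Submodule.span ℝ (Set.range f) = W := by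
    obtain ⟨f, hf, hfspan, -⟩ :=
      Submodule.exists_fun_fin_finrank_span_eq ℝ (rowFunctional A B '' S)
    exact ⟨_, hpos, hrank, f, hf, hfspan⟩
  choose r _ hr using hf
  -- The last of the `k` rows is repeated to reach exactly `m + 1`; this needs `0 < k`.
  refine ⟨fun j => r ⟨min j (k - 1), by omega⟩, ?_⟩
  have hspan : Submodule.span ℝ (Set.range (rowFunctional A B ∘
      fun j : Fin (m + 1) => r ⟨min j (k - 1), by omega⟩)) = W := by
    rw [← hfspan]
    congr 1
    ext φ
    constructor
    · rintro ⟨j, rfl⟩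
      exact ⟨_, (hr _).symm⟩
    · rintro ⟨j, rfl⟩
      have hj := j.2
      refine ⟨⟨j, by omega⟩, ?_⟩
      simp only [Function.comp_apply]
      rw [hr]
      congr 1
      ext
      simp only
      omega
  rw [hspan]
  exact ⟨hmem, hline⟩

/-- A polytope with a formulation of size `N` with `m` additional variables has at most
`N ^ (m + 1)` facets. -/
lemma card_le_of_isFacetNormal {d m N : ℕ} {P : Set (Fin d → ℝ)} (hP : HasFormulation P m N)
    {ι : Type*} [Fintype ι] (u : ι → Fin d → ℝ) (hu0 : ∀ i, u i ≠ 0)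
    (hu : ∀ i, IsFacetNormal P (u i)) (hinj : ∀ i j (c : ℝ), u i = c • u j → i = j) :
    Fintype.card ι ≤ N ^ (m + 1) := by
  obtain ⟨A, B, b, hform⟩ := hP
  choose g hg hg' using fun i => exists_rows_of_isFacetNormal hform (hu0 i) (hu i)
  have hginj : Function.Injective g := by
    intro i j hij
    obtain ⟨c, hc⟩ := hg' j (u i) (hij ▸ hg i)
    exact hinj i j c hc
  simpa using Fintype.card_le_of_injective g hginj

lemma hasFormulation_zero_of_rows {d : ℕ} {κ : Type*} [Fintype κ] {P : Set (Fin d → ℝ)}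
    (a : κ → Fin d → ℝ) (b : κ → ℝ) (hP : ∀ x, x ∈ P ↔ ∀ j, a j ⬝ᵥ x ≤ b j)
    (R : ℝ) (hR : ∀ x ∈ P, ∀ j, |x j| ≤ R) : HasFormulation P 0 (Fintype.card κ) := by
  let e := (Fintype.equivFin κ).symm
  have hmem : ∀ x y, (x, y) ∈ solutionSet (N := Fintype.card κ) (m := 0)
      (fun j => a (e j)) 0 (fun j => b (e j)) ↔ x ∈ P := by
    intro x y
    rw [hP, ← e.forall_congr_right (q := fun j => a j ⬝ᵥ x ≤ b j)]
    simp only [solutionSet, Matrix.zero_mulVec, add_zero]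
    rfl
  refine ⟨fun j => a (e j), 0, fun j => b (e j), ?_, ?_⟩
  · rw [isBounded_iff_forall_norm_le]
    refine ⟨max R 0, fun z hz => ?_⟩
    have hz' := hR _ ((hmem z.1 z.2).1 hz)
    rw [Prod.norm_def, Subsingleton.elim z.2 0, norm_zero]
    refine max_le ?_ (le_max_right _ _)
    exact (pi_norm_le_iff_of_nonneg (le_max_right _ _)).2 fun j => (hz' j).trans (le_max_left _ _)
  · ext x
    simp only [Set.mem_ofPred_eq, hmem, exists_const]

/-! ### The two polytopes -/

section Construction

variable {d k : ℕ} (e : Fin k ⊕ Fin k ⊕ Unit ≃ Fin d)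

/-- The vector with the given blocks of coordinates. -/
def blockVec (a b : Fin k → ℝ) (t : ℝ) : Fin d → ℝ :=
  fun j => Sum.elim a (Sum.elim b fun _ => t) (e.symm j)

@[simp] lemma blockVec_inl (a b : Fin k → ℝ) (t : ℝ) (i : Fin k) :
    blockVec e a b t (e (.inl i)) = a i := by simp [blockVec]

@[simp] lemma blockVec_inr_inl (a b : Fin k → ℝ) (t : ℝ) (i : Fin k) :
    blockVec e a b t (e (.inr (.inl i))) = b i := by simp [blockVec]

@[simp] lemma blockVec_inr_inr (a b : Fin k → ℝ) (t : ℝ) (i : Unit) :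
    blockVec e a b t (e (.inr (.inr i))) = t := by simp [blockVec]

lemma dotProduct_eq_sum_blocks (u x : Fin d → ℝ) :
    u ⬝ᵥ x = ∑ i, (u (e (.inl i)) * x (e (.inl i)) + u (e (.inr (.inl i))) * x (e (.inr (.inl i))))
      + u (e (.inr (.inr ()))) * x (e (.inr (.inr ()))) := by
  rw [dotProduct, ← e.sum_comp, Fintype.sum_sum_type, Fintype.sum_sum_type,
    Finset.sum_add_distrib]
  simp [add_assoc]

/-- A product of `k` polygons, each with the `n` edge directions `(1, -(2 j + 1))`, `j < n`. -/
def polygonProduct (n : ℕ) : Set (Fin d → ℝ) :=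
  {x | (∀ (i : Fin k) (j : Fin n), (2 * (j : ℝ) + 1) * x (e (.inl i)) + x (e (.inr (.inl i)))
      ≤ j * (j + 1)) ∧
    (∀ i : Fin k, 0 ≤ x (e (.inl i))) ∧ (∀ i : Fin k, -(n : ℝ) ^ 2 ≤ x (e (.inr (.inl i)))) ∧
    x (e (.inr (.inr ()))) = 0}

/-- A simplex in the second block of coordinates, placed at height one. -/
def liftedSimplex : Set (Fin d → ℝ) :=
  {x | (∀ i : Fin k, x (e (.inl i)) = 0) ∧ (∀ i : Fin k, 0 ≤ x (e (.inr (.inl i)))) ∧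
    ∑ i, x (e (.inr (.inl i))) ≤ 1 ∧ x (e (.inr (.inr ()))) = 1}

lemma hasFormulation_polygonProduct {n : ℕ} (hn : 0 < n) :
    HasFormulation (polygonProduct e n) 0 (k * n + (k + (k + 2))) := by
  have key := hasFormulation_zero_of_rows (P := polygonProduct e n)
    (κ := (Fin k × Fin n) ⊕ Fin k ⊕ Fin k ⊕ Bool)
    (Sum.elim (fun p => Pi.single (e (.inl p.1)) (2 * (p.2 : ℝ) + 1)
        + Pi.single (e (.inr (.inl p.1))) 1)
      (Sum.elim (fun i => Pi.single (e (.inl i)) (-1))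
        (Sum.elim (fun i => Pi.single (e (.inr (.inl i))) (-1))
          (fun s => Pi.single (e (.inr (.inr ()))) (if s then 1 else -1)))))
    (Sum.elim (fun p => p.2 * (p.2 + 1)) (Sum.elim (fun _ => 0)
      (Sum.elim (fun _ => (n : ℝ) ^ 2) (fun _ => 0)))) ?_ ((n : ℝ) ^ 2) ?_
  · simpa using key
  · intro x
    simp [polygonProduct, add_dotProduct, single_dotProduct, neg_le, ← le_antisymm_iff, and_comm]
    exact fun _ _ _ => eq_comm
  · rintro x ⟨h1, h2, h3, h4⟩ j
    obtain ⟨j, rfl⟩ := e.surjective j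
    rw [abs_le]
    have hsq := sq_nonneg (n : ℝ)
    -- The edge `j = 0`, available because `0 < n`, bounds each polygon together with the two lower
    -- bounds.
    have h1' : ∀ i : Fin k, x (e (.inl i)) + x (e (.inr (.inl i))) ≤ 0 := fun i => by
      simpa using h1 i ⟨0, hn⟩
    rcases j with i | i | i
    · have := h1' i; have := h2 i; have := h3 i
      constructor <;> linarith
    · have := h1' i; have := h2 i; have := h3 i
      constructor <;> linarith
    · rw [h4]
      constructor <;> linarith

lemma hasFormulation_liftedSimplex :
    HasFormulation (liftedSimplex e) 0 (k * 2 + (k + (1 + 2))) := by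
  have key := hasFormulation_zero_of_rows (P := liftedSimplex e)
    (κ := (Fin k × Bool) ⊕ Fin k ⊕ Unit ⊕ Bool)
    (Sum.elim (fun p => Pi.single (e (.inl p.1)) (if p.2 then 1 else -1))
      (Sum.elim (fun i => Pi.single (e (.inr (.inl i))) (-1))
        (Sum.elim (fun _ => ∑ i : Fin k, Pi.single (e (.inr (.inl i))) 1)
          (fun s => Pi.single (e (.inr (.inr ()))) (if s then 1 else -1)))))
    (Sum.elim (fun _ => 0) (Sum.elim (fun _ => 0)
      (Sum.elim (fun _ => 1) (fun s => if s then 1 else -1)))) ?_ 1 ?_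
  · simpa using key
  · intro x
    simp [liftedSimplex, sum_dotProduct, single_dotProduct, Prod.forall, ← le_antisymm_iff, and_comm]
    simp only [eq_comm]
  · rintro x ⟨h1, h2, h3, h4⟩ j
    obtain ⟨j, rfl⟩ := e.surjective j
    rcases j with i | i | i
    · simp [h1]
    · rw [abs_of_nonneg (h2 i)]
      exact (Finset.single_le_sum (f := fun i : Fin k => x (e (.inr (.inl i))))
        (fun i _ => h2 i) (Finset.mem_univ i)).trans h3
    · simp [h4]

lemma polygonProduct_nonempty (n : ℕ) : (polygonProduct e n).Nonempty := by
  refine ⟨0, ?_, ?_, ?_, rfl⟩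
  · intro i j
    simp only [Pi.zero_apply, mul_zero, add_zero]
    positivity
  · simp
  · intro i
    simp only [Pi.zero_apply]
    nlinarith [sq_nonneg (n : ℝ)]

lemma liftedSimplex_nonempty : (liftedSimplex e).Nonempty :=
  ⟨blockVec e 0 0 1, by simp [liftedSimplex]⟩

/-! ### Facets of the convex hull -/

/-- The facet normal of the convex hull which selects the edge `J i` in the `i`-th polygon. -/
noncomputable def edgeNormal {n : ℕ} (J : Fin k → Fin n) : Fin d → ℝ :=
  blockVec e (fun i => 2 * (J i : ℝ) + 1) 1 (∑ i, (J i : ℝ) * (J i + 1) - 1)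

/-- The vertex of the product of polygons given by the first endpoints of the edges `J`, with the
second endpoint in at most one coordinate pair `o`. -/
noncomputable def edgePoint {n : ℕ} (J : Fin k → Fin n) (o : Option (Fin k)) : Fin d → ℝ :=
  blockVec e (fun i => J i + if o = some i then 1 else 0)
    (fun i => -((J i : ℝ) ^ 2 + if o = some i then 2 * (J i : ℝ) + 1 else 0)) 0

/-- The `i`-th vertex of the lifted simplex. -/
noncomputable def simplexVertex (i : Fin k) : Fin d → ℝ :=
  blockVec e 0 (Pi.single i 1) 1

/-- Edge endpoints are integer points `(a, -a²)` on a parabola. There the `j`-th edge inequality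
reads `0 ≤ (a - j) * (a - j - 1)`, a product of consecutive integers. -/
lemma edgePoint_mem {n : ℕ} (J : Fin k → Fin n) (o : Option (Fin k)) :
    edgePoint e J o ∈ polygonProduct e n := by
  refine ⟨fun i j => ?_, fun i => ?_, fun i => ?_, by simp [edgePoint]⟩
  · simp only [edgePoint, blockVec_inl, blockVec_inr_inl]
    generalize (J i : ℕ) = a
    generalize (j : ℕ) = b
    split_ifs
    · have : (0 : ℤ) ≤ (a - b) * (a - b + 1) := by
        rcases le_or_gt 0 ((a : ℤ) - b) with h | h <;> nlinarith
      have : (0 : ℝ) ≤ (a - b) * (a - b + 1) := by exact_mod_cast this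
      nlinarith
    · have : (0 : ℤ) ≤ (a - b) * (a - b - 1) := by
        rcases le_or_gt ((a : ℤ) - b) 0 with h | h <;> nlinarith
      have : (0 : ℝ) ≤ (a - b) * (a - b - 1) := by exact_mod_cast this
      nlinarith
  · simp only [edgePoint, blockVec_inl]
    positivity
  · simp only [edgePoint, blockVec_inr_inl]
    have h : ((J i : ℕ) : ℝ) + 1 ≤ n := by exact_mod_cast (J i).2
    have h0 : (0 : ℝ) ≤ (J i : ℕ) := Nat.cast_nonneg _
    split_ifs <;> nlinarith

lemma simplexVertex_mem (i : Fin k) : simplexVertex e i ∈ liftedSimplex e := by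
  refine ⟨by simp [simplexVertex], fun j => ?_, by simp [simplexVertex], by simp [simplexVertex]⟩
  simp only [simplexVertex, blockVec_inr_inl, Pi.single_apply]
  split_ifs <;> norm_num

lemma dotProduct_edgePoint_none {n : ℕ} (J : Fin k → Fin n) (w : Fin d → ℝ) :
    w ⬝ᵥ edgePoint e J none =
      ∑ i, (w (e (.inl i)) * J i - w (e (.inr (.inl i))) * (J i : ℝ) ^ 2) := by
  rw [dotProduct_eq_sum_blocks e]
  simp [edgePoint, sub_eq_add_neg]

lemma dotProduct_edgePoint_some {n : ℕ} (J : Fin k → Fin n) (w : Fin d → ℝ) (i : Fin k) :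
    w ⬝ᵥ edgePoint e J (some i) = w ⬝ᵥ edgePoint e J none +
      (w (e (.inl i)) - (2 * J i + 1) * w (e (.inr (.inl i)))) := by
  rw [dotProduct_edgePoint_none, dotProduct_eq_sum_blocks e]
  have : w (e (.inl i)) - (2 * J i + 1) * w (e (.inr (.inl i))) =
      ∑ j, if i = j then w (e (.inl j)) - (2 * J j + 1) * w (e (.inr (.inl j))) else 0 := by simp
  rw [this, ← Finset.sum_add_distrib]
  simp only [edgePoint, blockVec_inl, blockVec_inr_inl, blockVec_inr_inr, mul_zero, add_zero,
    Option.some.injEq]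
  refine Finset.sum_congr rfl fun j _ => ?_
  split_ifs <;> ring

lemma dotProduct_simplexVertex (w : Fin d → ℝ) (i : Fin k) :
    w ⬝ᵥ simplexVertex e i = w (e (.inr (.inl i))) + w (e (.inr (.inr ()))) := by
  rw [dotProduct_eq_sum_blocks e]
  simp [simplexVertex, Pi.single_apply]

lemma edgeNormal_dotProduct_edgePoint {n : ℕ} (J : Fin k → Fin n) (o : Option (Fin k)) :
    edgeNormal e J ⬝ᵥ edgePoint e J o = ∑ i, (J i : ℝ) * (J i + 1) := by
  have h : edgeNormal e J ⬝ᵥ edgePoint e J none = ∑ i, (J i : ℝ) * (J i + 1) := by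
    rw [dotProduct_edgePoint_none]
    refine Finset.sum_congr rfl fun j _ => ?_
    simp [edgeNormal]
    ring
  cases o with
  | none => exact h
  | some i =>
    rw [dotProduct_edgePoint_some, h]
    simp [edgeNormal]

/-- The last entry of `edgeNormal` is chosen to make this value agree with the one on the edge
points. -/
lemma edgeNormal_dotProduct_simplexVertex {n : ℕ} (J : Fin k → Fin n) (i : Fin k) :
    edgeNormal e J ⬝ᵥ simplexVertex e i = ∑ i, (J i : ℝ) * (J i + 1) := by
  rw [dotProduct_simplexVertex]
  simp [edgeNormal]

lemma edgeNormal_dotProduct_le {n : ℕ} (J : Fin k → Fin n) {x : Fin d → ℝ}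
    (hx : x ∈ convexHull ℝ (polygonProduct e n ∪ liftedSimplex e)) :
    edgeNormal e J ⬝ᵥ x ≤ ∑ i, (J i : ℝ) * (J i + 1) := by
  have hconv : Convex ℝ {x | edgeNormal e J ⬝ᵥ x ≤ ∑ i, (J i : ℝ) * (J i + 1)} :=
    convex_halfSpace_le ((dotProductBilin ℝ ℝ (edgeNormal e J)).isLinear) _
  refine convexHull_min ?_ hconv hx
  rintro y (hy | hy)
  · obtain ⟨h1, -, -, h4⟩ := hy
    rw [Set.mem_ofPred_eq, dotProduct_eq_sum_blocks e, h4, mul_zero, add_zero]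
    refine Finset.sum_le_sum fun i _ => ?_
    simpa [edgeNormal] using h1 i (J i)
  · obtain ⟨h1, -, h3, h4⟩ := hy
    rw [Set.mem_ofPred_eq, dotProduct_eq_sum_blocks e, h4]
    simp [edgeNormal, h1]
    linarith

/-- The `k + 1` edge points and `k` simplex vertices suffice: the vertices make the second block of
`w` constant, the step along each edge then fixes the first block, and comparing the two heights
fixes the last entry. -/
lemma isFacetNormal_edgeNormal {n : ℕ} (J : Fin k → Fin n) :
    IsFacetNormal (convexHull ℝ (polygonProduct e n ∪ liftedSimplex e)) (edgeNormal e J) := by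
  classical
  have hsub := subset_convexHull ℝ (polygonProduct e n ∪ liftedSimplex e)
  set T : Finset (Fin d → ℝ) :=
    Finset.univ.image (edgePoint e J) ∪ Finset.univ.image (simplexVertex e) with hT
  have hTe : ∀ o, edgePoint e J o ∈ T := fun o => by simp [hT]
  have hTs : ∀ i, simplexVertex e i ∈ T := fun i => by simp [hT]
  have hTcases : ∀ p ∈ T, (∃ o, edgePoint e J o = p) ∨ ∃ i, simplexVertex e i = p := by
    intro p hp
    simpa [hT] using hp
  refine ⟨T, ⟨_, hTe none⟩, ?_, ?_, ?_⟩
  · intro p hp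
    obtain ⟨o, rfl⟩ | ⟨i, rfl⟩ := hTcases p hp
    · exact hsub (.inl (edgePoint_mem e J o))
    · exact hsub (.inr (simplexVertex_mem e i))
  · intro p hp x hx
    refine (edgeNormal_dotProduct_le e J hx).trans_eq ?_
    obtain ⟨o, rfl⟩ | ⟨i, rfl⟩ := hTcases p hp
    · rw [edgeNormal_dotProduct_edgePoint]
    · rw [edgeNormal_dotProduct_simplexVertex]
  · intro w hw
    set c := w ⬝ᵥ edgePoint e J none - w (e (.inr (.inr ()))) with hc
    have hb : ∀ i, w (e (.inr (.inl i))) = c := fun i => by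
      have := hw _ (hTs i) _ (hTe none)
      rw [dotProduct_simplexVertex] at this
      linarith
    have ha : ∀ i, w (e (.inl i)) = c * (2 * J i + 1) := fun i => by
      have := hw _ (hTe (some i)) _ (hTe none)
      rw [dotProduct_edgePoint_some, hb] at this
      linarith
    have ht : w (e (.inr (.inr ()))) = c * (∑ i, (J i : ℝ) * (J i + 1) - 1) := by
      have h : w ⬝ᵥ edgePoint e J none = c * ∑ i, (J i : ℝ) * (J i + 1) := by
        rw [dotProduct_edgePoint_none, Finset.mul_sum]
        refine Finset.sum_congr rfl fun i _ => ?_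
        rw [ha, hb]
        ring
      linarith
    refine ⟨c, funext fun j => ?_⟩
    obtain ⟨i | i | i, rfl⟩ := e.surjective j
    · simpa [edgeNormal] using ha i
    · simpa [edgeNormal] using hb i
    · simpa [edgeNormal] using ht

lemma edgeNormal_ne_zero {n : ℕ} (hk : 0 < k) (J : Fin k → Fin n) : edgeNormal e J ≠ 0 := by
  intro h
  have := congrFun h (e (.inr (.inl ⟨0, hk⟩)))
  simp [edgeNormal] at this

lemma edgeNormal_eq_smul {n : ℕ} (hk : 0 < k) (J J' : Fin k → Fin n) (c : ℝ)
    (h : edgeNormal e J = c • edgeNormal e J') : J = J' := by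
  have hc := congrFun h (e (.inr (.inl ⟨0, hk⟩)))
  simp only [edgeNormal, blockVec_inr_inl, Pi.one_apply, Pi.smul_apply, smul_eq_mul,
    mul_one] at hc
  ext i
  have := congrFun h (e (.inl i))
  simpa [edgeNormal, ← hc] using this

/-- Every formulation of the convex hull of the two polytopes satisfies this trade-off between
its size `N` and its number `m` of additional variables. -/
lemma pow_le_of_hasFormulation {n m N : ℕ} (hk : 0 < k)
    (h : HasFormulation (convexHull ℝ (polygonProduct e n ∪ liftedSimplex e)) m N) :
    n ^ k ≤ N ^ (m + 1) := by
  simpa using card_le_of_isFacetNormal h (fun J : Fin k → Fin n => edgeNormal e J)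
    (edgeNormal_ne_zero e hk) (isFacetNormal_edgeNormal e) (edgeNormal_eq_smul e hk)

end Construction

/-! ### Asymptotics -/

lemma Polynomial.exists_eval_le_mul_pow (σ : Polynomial ℝ) :
    ∃ (C D : ℕ), ∀ x : ℝ, 1 ≤ x → σ.eval x ≤ C * x ^ D := by
  obtain ⟨C, hC⟩ := exists_nat_ge (∑ i ∈ Finset.range (σ.natDegree + 1), |σ.coeff i|)
  refine ⟨C, σ.natDegree, fun x hx => ?_⟩
  rw [Polynomial.eval_eq_sum_range]
  refine le_trans ?_ (mul_le_mul_of_nonneg_right hC (by positivity))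
  rw [Finset.sum_mul]
  refine Finset.sum_le_sum fun i hi => ?_
  have hi' : i ≤ σ.natDegree := Nat.lt_succ_iff.1 (Finset.mem_range.1 hi)
  have hp : x ^ i ≤ x ^ σ.natDegree := pow_le_pow_right₀ hx hi'
  exact mul_le_mul (le_abs_self _) hp (by positivity) (abs_nonneg _)

theorem theorem2 (σ : Polynomial ℝ) :
    ∃ (c : ℝ) (d₀ : ℕ), 0 < c ∧
      ∀ d : ℕ, Odd d →
        ∃ (P₁ P₂ : Set (Fin d → ℝ)) (f₁ f₂ : ℕ),
          P₁.Nonempty ∧ P₂.Nonempty ∧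
          HasFormulation P₁ 0 f₁ ∧ HasFormulation P₂ 0 f₂ ∧
          (d₀ ≤ d → ∀ m N : ℕ, (N : ℝ) ≤ σ.eval ((f₁ : ℝ) + (f₂ : ℝ)) →
            HasFormulation (convexHull ℝ (P₁ ∪ P₂)) m N → c * (d : ℝ) ≤ (m : ℝ)) := by
  obtain ⟨C, D, hσ⟩ := σ.exists_eval_le_mul_pow
  -- The summand `C * 11 ^ D` lets one factor `d` absorb the constants in the size bound. The rest
  -- absorbs the additive terms when `k ≤ (2 * D + 1) * (m + 1)` is turned into `d ≤ 4 * (2 * D + 1)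
  -- * m`.
  refine ⟨1 / (4 * (2 * D + 1)), C * 11 ^ D + 4 * (2 * D + 1) + 3, by positivity, ?_⟩
  rintro d ⟨k, hk⟩
  have hd : 0 < d := by omega
  let e : Fin k ⊕ Fin k ⊕ Unit ≃ Fin d := Fintype.equivOfCardEq (by simp; omega)
  refine ⟨polygonProduct e d, liftedSimplex e, _, _, polygonProduct_nonempty e d,
    liftedSimplex_nonempty e, hasFormulation_polygonProduct e hd,
    hasFormulation_liftedSimplex e, fun hd₀ m N hN hform => ?_⟩
  have hpow := pow_le_of_hasFormulation e (by omega) hform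
  have hf : (k * d + (k + (k + 2))) + (k * 2 + (k + (1 + 2))) ≤ 11 * d ^ 2 := by
    subst hk
    nlinarith
  have hNle : N ≤ d ^ (2 * D + 1) := by
    have h1 : (N : ℝ) ≤ C * (11 * (d : ℝ) ^ 2) ^ D := by
      refine (hN.trans (hσ _ ?_)).trans ?_
      · norm_cast
        omega
      · gcongr
        exact_mod_cast hf
    have h2 : N ≤ C * (11 * d ^ 2) ^ D := by exact_mod_cast h1
    calc N ≤ C * (11 * d ^ 2) ^ D := h2
      _ = (C * 11 ^ D) * d ^ (2 * D) := by rw [mul_pow, ← pow_mul, mul_assoc]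
      _ ≤ d * d ^ (2 * D) := Nat.mul_le_mul_right _ (by omega)
      _ = d ^ (2 * D + 1) := by rw [pow_succ, mul_comm]
  have hexp : k ≤ (2 * D + 1) * (m + 1) := by
    have h : d ^ k ≤ d ^ ((2 * D + 1) * (m + 1)) := by
      rw [pow_mul]
      exact hpow.trans (Nat.pow_le_pow_left hNle _)
    exact (Nat.pow_le_pow_iff_right (by omega)).1 h
  have hlin : d ≤ 4 * (2 * D + 1) * m := by
    have h1 : 4 * (2 * D + 1) + 3 ≤ d := by omega
    nlinarith
  rw [one_div, inv_mul_le_iff₀ (by positivity)]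
  exact_mod_cast hlin
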